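/- For a discrete group $G$, let $\ell^2(G)$ be the complex Hilbert space of square-summable functions $G\to\mathbf C$, on which $\mathbf C[G]$ acts from the left by the left regular representation, and let $C^*_{\mathbf R}(G)$ be the closure, in the operator norm, of the real group ring $\mathbf R[G]$ in the algebra of bounded operators on $\ell^2(G)$; it is contained in the reduced $C^*$-algebra $C^*_r(G)$, the norm closure of $\mathbf C[G]$. The algebra $C^*_r(G)$ acts on $\ell^2(G)$ from the right by $vu=(u^*v^*)^*$, where $v^*(g)=\overline{v(g^{-1})}$; this extends right multiplication by elements of $\mathbf C[G]$. Proposition. Let $F$ be the free group with generators $a_1,a_2$ and let $\pi=F\times F\times F$. There exist $u_1,u_2\in C^*_{\mathbf R}(F)$ such that (i) $u_1(a_1-1)+u_2(a_2-1)=0$; (ii) if $F$ is identified with any one of the three factors of $\pi$, so that $C^*_r(F)\subset C^*_r(\pi)$ acts on $\ell^2(\pi)$ from the right, then for every pair $v_1,v_2\in\ell^2(\pi)$ with $v_1(a_1-1)+v_2(a_2-1)=0$ there exists a unique $w\in\ell^2(\pi)$ such that $v_1=wu_1$ and $v_2=wu_2$. -/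

import Mathlib

noncomputable section

/-- The complex Hilbert space `ℓ²(G)` of square-summable functions on a discrete group `G`. -/
abbrev L2 (G : Type*) : Type _ := lp (fun _ : G => ℂ) 2

/-- The bounded operators on `ℓ²(G)`, with the operator norm. -/
abbrev L2Op (G : Type*) : Type _ := L2 G →L[ℂ] L2 G

theorem L2.hasSum_sq {G : Type*} (v : L2 G) : HasSum (fun g => ‖v g‖ ^ 2) (‖v‖ ^ 2) := by
  simpa using lp.hasSum_norm (p := 2) (by norm_num) v

theorem L2.memℓp_of_summable {G : Type*} {f : G → ℂ} (h : Summable fun g => ‖f g‖ ^ 2) :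
    Memℓp f 2 :=
  memℓp_gen (by simpa using h)

/-- The pull-back `v ∘ e` of a square-summable function along an injective map. -/
def L2.comp {G H : Type*} (v : L2 G) (e : H → G) (he : Function.Injective e) : L2 H :=
  ⟨fun h => v (e h), L2.memℓp_of_summable ((L2.hasSum_sq v).summable.comp_injective he)⟩

/-- The left regular representation: `(leftRegular G h v) g = v (h⁻¹ * g)`. -/
def leftRegular (G : Type*) [Group G] : G →* L2Op G where
  toFun h := LinearMap.mkContinuous
    { toFun := fun v => L2.comp v (fun g => h⁻¹ * g) (mul_right_injective h⁻¹)
      map_add' := fun _ _ => rfl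
      map_smul' := fun _ _ => rfl } 1 (fun v => by
        rw [one_mul]
        refine le_of_sq_le_sq ?_ (norm_nonneg v)
        refine ((L2.hasSum_sq _).unique ?_).le
        exact (Equiv.mulLeft h⁻¹).hasSum_iff.mpr (L2.hasSum_sq v))
  map_one' := by
    ext v g
    exact congrArg v (by simp)
  map_mul' h k := by
    ext v g
    exact congrArg v (by simp [mul_assoc])

theorem leftRegular_apply {G : Type*} [Group G] (h : G) (v : L2 G) (g : G) :
    leftRegular G h v g = v (h⁻¹ * g) := rfl

/-- The operators on `ℓ²(G)` given by the real group ring `ℝ[G]`. -/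
def realGroupRing (G : Type*) [Group G] : Subalgebra ℝ (L2Op G) :=
  (MonoidAlgebra.lift ℝ (L2Op G) G (leftRegular G)).range

/-- The real part of the reduced C*-algebra of `G`: the operator-norm closure of the real group
ring, acting on `ℓ²(G)` by the left regular representation. -/
def realReducedCStar (G : Type*) [Group G] : Subalgebra ℝ (L2Op G) :=
  (realGroupRing G).topologicalClosure

/-- The conjugation `v ↦ v*` of `ℓ²(G)`, `v* g = conj (v g⁻¹)`. -/
def L2.adj {G : Type*} [Group G] (v : L2 G) : L2 G :=
  star (L2.comp v (fun g => g⁻¹) inv_injective)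

/-- The right action `v u = (u* v*)*` on `ℓ²(G)` of the left convolution operators `u`
on `ℓ²(G)`. -/
def L2.rightAct {G : Type*} [Group G] (v : L2 G) (u : L2Op G) : L2 G :=
  L2.adj (ContinuousLinearMap.adjoint u (L2.adj v))

theorem leftRegular_adjoint {G : Type*} [Group G] (h : G) :
    ContinuousLinearMap.adjoint (leftRegular G h) = leftRegular G h⁻¹ := by
  symm
  rw [ContinuousLinearMap.eq_adjoint_iff]
  intro x y
  rw [lp.inner_eq_tsum, lp.inner_eq_tsum, ← (Equiv.mulLeft h⁻¹).tsum_eq]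
  simp [leftRegular_apply]

/-- A group element acts on the right by right translation. -/
theorem L2.rightAct_leftRegular {G : Type*} [Group G] (v : L2 G) (h g : G) :
    L2.rightAct v (leftRegular G h) g = v (g * h⁻¹) := by
  have : L2.rightAct v (leftRegular G h) g = star (star (v ((h⁻¹)⁻¹ * g⁻¹)⁻¹)) := by
    rw [L2.rightAct, leftRegular_adjoint]
    rfl
  rw [this, star_star]
  simp

section Factor

variable {I G : Type*} [DecidableEq I]

/-- The restriction `k ↦ v (g with r-th coordinate replaced by k)` of `v`. -/
def L2.slice (r : I) (g : I → G) (v : L2 (I → G)) : L2 G :=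
  L2.comp v (Function.update g r) (Function.update_injective g r)

theorem L2.slice_update (r : I) (g : I → G) (k : G) (v : L2 (I → G)) :
    L2.slice r (Function.update g r k) v = L2.slice r g v := by
  ext l
  exact congrArg v (by simp)

/-- The splitting of `I → G` into the remaining coordinates and the `r`-th one. -/
def splitFactor (r : I) : ({j // j ≠ r} → G) × G ≃ (I → G) :=
  (Equiv.prodComm _ _).trans (Equiv.funSplitAt r G).symm

theorem splitFactor_apply_self (r : I) (p : ({j // j ≠ r} → G) × G) : splitFactor r p r = p.2 := by
  simp [splitFactor, Equiv.funSplitAt, Equiv.piSplitAt]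

theorem splitFactor_update (r : I) (f : {j // j ≠ r} → G) (k l : G) :
    Function.update (splitFactor r (f, k)) r l = splitFactor r (f, l) := by
  ext j
  by_cases hj : j = r
  · subst hj
    simp [splitFactor_apply_self]
  · simp [splitFactor, Equiv.funSplitAt, Equiv.piSplitAt, hj]

theorem L2.factor_hasSum (r : I) (T : L2Op G) (v : L2 (I → G)) :
    ∃ s ≤ (‖T‖ * ‖v‖) ^ 2, HasSum (fun g : I → G => ‖T (L2.slice r g v) (g r)‖ ^ 2) s := by
  rcases isEmpty_or_nonempty G with hG | ⟨⟨k₀⟩⟩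
  · have : IsEmpty (I → G) := ⟨fun g => hG.elim (g r)⟩
    exact ⟨0, sq_nonneg _, hasSum_empty⟩
  let S : ({j // j ≠ r} → G) → L2 G := fun f => L2.slice r (splitFactor r (f, k₀)) v
  have hS (f) (k) : L2.slice r (splitFactor r (f, k)) v = S f := by
    rw [← splitFactor_update r f k₀ k, L2.slice_update]
  have hSv : HasSum (fun f => ‖S f‖ ^ 2) (‖v‖ ^ 2) := by
    have h := (splitFactor r).hasSum_iff.mpr (L2.hasSum_sq v)
    refine h.prod_fiberwise fun f => ?_
    refine (L2.hasSum_sq (S f)).congr_fun ?_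
    intro k
    change ‖v _‖ ^ 2 = ‖v (Function.update _ r k)‖ ^ 2
    rw [splitFactor_update]
  have hT (f) : ‖T (S f)‖ ^ 2 ≤ ‖T‖ ^ 2 * ‖S f‖ ^ 2 := by
    rw [← mul_pow]
    gcongr
    exact T.le_opNorm _
  have hsum : Summable fun f => ‖T (S f)‖ ^ 2 :=
    Summable.of_nonneg_of_le (fun _ => sq_nonneg _) hT (hSv.summable.mul_left _)
  have hfun : (fun g : I → G => ‖T (L2.slice r g v) (g r)‖ ^ 2) ∘ splitFactor r
      = fun p => ‖T (S p.1) p.2‖ ^ 2 := by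
    ext p
    simp only [Function.comp_apply, splitFactor_apply_self]
    rw [show p = (p.1, p.2) from rfl, hS]
  have hprod : Summable fun p : ({j // j ≠ r} → G) × G => ‖T (S p.1) p.2‖ ^ 2 := by
    refine (summable_prod_of_nonneg fun _ => sq_nonneg _).mpr
      ⟨fun f => (L2.hasSum_sq (T (S f))).summable, ?_⟩
    simpa only [(L2.hasSum_sq (T (S _))).tsum_eq] using hsum
  refine ⟨∑' p : ({j // j ≠ r} → G) × G, ‖T (S p.1) p.2‖ ^ 2, ?_,
    (splitFactor r).hasSum_iff.mp ?_⟩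
  swap
  · rw [hfun]
    exact hprod.hasSum
  rw [hprod.tsum_prod]
  simp only [(L2.hasSum_sq (T (S _))).tsum_eq]
  calc _ ≤ ∑' f, ‖T‖ ^ 2 * ‖S f‖ ^ 2 := hsum.tsum_le_tsum hT (hSv.summable.mul_left _)
    _ = _ := by rw [tsum_mul_left, hSv.tsum_eq, mul_pow]

/-- The function `g ↦ (T (v restricted to the line through g in direction r)) (g r)`. -/
def L2.factorFun (r : I) (T : L2Op G) (v : L2 (I → G)) : L2 (I → G) :=
  ⟨fun g => T (L2.slice r g v) (g r),
    L2.memℓp_of_summable (L2.factor_hasSum r T v).choose_spec.2.summable⟩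

theorem L2.factorFun_add (r : I) (T : L2Op G) (v w : L2 (I → G)) :
    L2.factorFun r T (v + w) = L2.factorFun r T v + L2.factorFun r T w := by
  ext g
  have h : L2.slice r g (v + w) = L2.slice r g v + L2.slice r g w := rfl
  change T (L2.slice r g (v + w)) (g r) = T (L2.slice r g v) (g r) + T (L2.slice r g w) (g r)
  rw [h, map_add, lp.coeFn_add, Pi.add_apply]

theorem L2.factorFun_smul (r : I) (T : L2Op G) (c : ℂ) (v : L2 (I → G)) :
    L2.factorFun r T (c • v) = c • L2.factorFun r T v := by
  ext g
  have h : L2.slice r g (c • v) = c • L2.slice r g v := rfl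
  change T (L2.slice r g (c • v)) (g r) = c • T (L2.slice r g v) (g r)
  rw [h, map_smul, lp.coeFn_smul, Pi.smul_apply]

theorem L2.norm_factorFun_le (r : I) (T : L2Op G) (v : L2 (I → G)) :
    ‖L2.factorFun r T v‖ ≤ ‖T‖ * ‖v‖ := by
  obtain ⟨s, hs, h⟩ := L2.factor_hasSum r T v
  refine le_of_sq_le_sq ?_ (by positivity)
  exact ((L2.hasSum_sq (L2.factorFun r T v)).unique h).trans_le hs

/-- The operator `T` on `ℓ²(G)` acting in the `r`-th factor of
`ℓ²(I → G)`, that is, `T ⊗ 1` on `ℓ²(G) ⊗ ℓ²({j // j ≠ r} → G)`. -/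
def factorOp (r : I) (T : L2Op G) : L2Op (I → G) :=
  LinearMap.mkContinuous
    { toFun := L2.factorFun r T
      map_add' := L2.factorFun_add r T
      map_smul' := L2.factorFun_smul r T } ‖T‖ (L2.norm_factorFun_le r T)

theorem factorOp_apply (r : I) (T : L2Op G) (v : L2 (I → G)) (g : I → G) :
    factorOp r T v g = T (L2.slice r g v) (g r) := rfl

/-- `factorOp r` extends the inclusion of `G` as the `r`-th factor of `I → G`. -/
theorem factorOp_leftRegular [Group G] (r : I) (h : G) :
    factorOp r (leftRegular G h) = leftRegular (I → G) (Pi.mulSingle r h) := by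
  ext v g
  refine congrArg v ?_
  ext j
  by_cases hj : j = r
  · subst hj
    simp
  · simp [hj]

end Factor

/-- The free group with the two generators `FreeGroup.of 0` and `FreeGroup.of 1`. -/
abbrev F2 : Type := FreeGroup (Fin 2)

end

/-!
The column `(a₁ - 1, a₂ - 1)` can be completed to an invertible `2 × 2` matrix over `C*_ℝ(F)` as
soon as `(a₁ - 1) + c (a₂ - 1)` is invertible there for some `c`. Already `c = 1` works: the element
`t = 2 - a₁ - a₂` is invertible in `C*_ℝ(F)`. With `s = t⁻¹`, the elements `u₁ = (a₂ - 1) s` and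
`u₂ = 1 + (a₂ - 1) s` satisfy `u₁ (a₁ - 1) + u₂ (a₂ - 1) = 0`, and the solutions `(v₁, v₂)` of
`v₁ (a₁ - 1) + v₂ (a₂ - 1) = 0` in any right module are exactly the pairs `(w u₁, w u₂)`, where
`w = v₂ - v₁` is determined by the pair because `u₂ - u₁ = 1` (`existsUnique_syzygy`). The module
`ℓ²(π)` enters only through the fact that `factorOp r` is a ring homomorphism and that
`L2.rightAct` is a right action.

The inverse exists because `t = 3 (1 - x)` with `x = (1 + a₁ + a₂) / 3`, and `‖x‖ < 1`: this is the
nonamenability of `F` in quantitative form, and it puts the Neumann series of `(1 - x)⁻¹` inside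
the norm-closed algebra `C*_ℝ(F)`. The estimate is a Schur test. In
`2 Re ⟪v, aᵢ v⟫ ≤ ∑ 2 |v g| |v (aᵢ⁻¹ g)|` each product is split by the weighted inequality between
the geometric and the arithmetic mean, with weight `2` at the end of the edge `{g, aᵢ⁻¹ g}` of the
Cayley tree that lies farther from the root `1`, and weight `1/2` at the other end. A vertex has at
most one edge leading to the root and four edges in all, so it collects a total weight of at most
`2 + 3 / 2 = 7 / 2`, which is less than `4` (`re_inner_leftRegular_add_le`).
-/

/-! ### Multiplicativity of `factorOp` and of the right action -/

theorem factorOp_add {I G : Type*} [DecidableEq I] (r : I) (S T : L2Op G) :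
    factorOp r (S + T) = factorOp r S + factorOp r T := rfl

theorem factorOp_one {I G : Type*} [DecidableEq I] (r : I) :
    factorOp r (1 : L2Op G) = 1 := by
  ext v g
  exact congrArg v (Function.update_eq_self r g)

theorem factorOp_mul {I G : Type*} [DecidableEq I] (r : I) (S T : L2Op G) :
    factorOp r (S * T) = factorOp r S * factorOp r T := by
  ext v g
  have h : L2.slice r g (factorOp r T v) = T (L2.slice r g v) := by
    ext k
    change T (L2.slice r (Function.update g r k) v) (Function.update g r k r) = _
    rw [L2.slice_update, Function.update_self]
  change S (T (L2.slice r g v)) (g r) = S (L2.slice r g (factorOp r T v)) (g r)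
  rw [h]

/-- `factorOp r` as a homomorphism of rings. -/
noncomputable def factorHom {I : Type*} [DecidableEq I] (G : Type*) (r : I) : L2Op G →+* L2Op (I → G) where
  toFun := factorOp r
  map_one' := factorOp_one r
  map_mul' := factorOp_mul r
  map_zero' := rfl
  map_add' := factorOp_add r

theorem L2.adj_adj {G : Type*} [Group G] (v : L2 G) : L2.adj (L2.adj v) = v := by
  ext g
  change star (star (v g⁻¹⁻¹)) = v g
  rw [star_star, inv_inv]

theorem L2.adj_add {G : Type*} [Group G] (v w : L2 G) :
    L2.adj (v + w) = L2.adj v + L2.adj w := by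
  ext g
  exact star_add (v g⁻¹) (w g⁻¹)

theorem L2.rightAct_add {G : Type*} [Group G] (v : L2 G) (S T : L2Op G) :
    L2.rightAct v (S + T) = L2.rightAct v S + L2.rightAct v T := by
  simp only [L2.rightAct, map_add, add_apply, L2.adj_add]

theorem L2.add_rightAct {G : Type*} [Group G] (v w : L2 G) (T : L2Op G) :
    L2.rightAct (v + w) T = L2.rightAct v T + L2.rightAct w T := by
  simp only [L2.rightAct, map_add, L2.adj_add]

theorem L2.rightAct_one {G : Type*} [Group G] (v : L2 G) : L2.rightAct v 1 = v := by
  have h : ContinuousLinearMap.adjoint (1 : L2Op G) = 1 := star_one (L2Op G)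
  rw [L2.rightAct, h, one_apply_eq_self, L2.adj_adj]

theorem L2.rightAct_mul {G : Type*} [Group G] (v : L2 G) (S T : L2Op G) :
    L2.rightAct v (S * T) = L2.rightAct (L2.rightAct v S) T := by
  have h : ContinuousLinearMap.adjoint (S * T)
      = ContinuousLinearMap.adjoint T * ContinuousLinearMap.adjoint S := star_mul S T
  simp only [L2.rightAct, h, L2.adj_adj]
  rfl

/-- The right action as a homomorphism from the opposite ring, so that `ℓ²(G)` is a right module
over its bounded operators. -/
noncomputable def L2.rightActHom (G : Type*) [Group G] : (L2Op G)ᵐᵒᵖ →+* AddMonoid.End (L2 G) where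
  toFun u := AddMonoidHom.mk' (fun v => L2.rightAct v u.unop) fun v w => L2.add_rightAct v w _
  map_one' := by
    ext1 v
    exact L2.rightAct_one v
  map_mul' S T := by
    ext1 v
    exact L2.rightAct_mul v T.unop S.unop
  map_zero' := by
    ext1 v
    have h := L2.rightAct_add v 0 0
    rw [add_zero] at h
    exact left_eq_add.mp h
  map_add' S T := by
    ext1 v
    exact L2.rightAct_add v S.unop T.unop

/-! ### Syzygies of a pair with invertible sum -/

/-- If `s` is a right inverse of `-(d₁ + d₂)`, then the relations `v₁ d₁ + v₂ d₂ = 0` in a right module are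
freely generated by the pair `(d₂ s, 1 + d₂ s)`. The module is given by a ring homomorphism `ρ`
from the opposite ring to the endomorphisms of an abelian group. -/
theorem existsUnique_syzygy {R M : Type*} [Ring R] [AddCommGroup M] (ρ : Rᵐᵒᵖ →+* AddMonoid.End M)
    {d₁ d₂ s : R} (hs : (d₁ + d₂) * s = -1) {v₁ v₂ : M}
    (h : ρ (.op d₁) v₁ + ρ (.op d₂) v₂ = 0) :
    ∃! w : M, v₁ = ρ (.op (d₂ * s)) w ∧ v₂ = ρ (.op (1 + d₂ * s)) w := by
  have hone (w : M) : ρ (.op (1 + d₂ * s)) w = w + ρ (.op (d₂ * s)) w := by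
    rw [MulOpposite.op_add, map_add, MulOpposite.op_one, map_one]
    rfl
  have hmul (a b : R) (w : M) : ρ (.op (a * b)) w = ρ (.op b) (ρ (.op a) w) := by
    rw [MulOpposite.op_mul, map_mul]
    rfl
  have key : ρ (.op (d₂ * s)) (v₂ - v₁) = v₁ := by
    have hd : ρ (.op d₂) (v₂ - v₁) = -ρ (.op (d₁ + d₂)) v₁ := by
      rw [map_sub, eq_neg_of_add_eq_zero_right h, MulOpposite.op_add, map_add]
      change _ = -(ρ (.op d₁) v₁ + ρ (.op d₂) v₁)
      abel
    rw [hmul, hd, map_neg, ← hmul, hs, MulOpposite.op_neg, map_neg, MulOpposite.op_one, map_one]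
    exact neg_neg v₁
  refine ⟨v₂ - v₁, ⟨key.symm, ?_⟩, ?_⟩
  · rw [hone, key, sub_add_cancel]
  · rintro w ⟨h₁, h₂⟩
    rw [h₁, h₂, hone, add_sub_cancel_right]

/-! ### The Schur test on the Cayley tree -/

/-- The weighted inequality of the arithmetic and geometric mean, applied to all terms of the inner
product of `v` with its translate by `h`. -/
theorem two_mul_re_inner_leftRegular_le {G : Type*} [Group G] (h : G) (w : G → ℝ) {C : ℝ}
    (hpos : ∀ g, 0 < w g) (hw : ∀ g, w g ≤ C) (hw' : ∀ g, (w g)⁻¹ ≤ C) (v : L2 G) :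
    Summable (fun g => (w g + (w (h * g))⁻¹) * ‖v g‖ ^ 2) ∧
    2 * (inner ℂ v (leftRegular G h v)).re ≤ ∑' g, (w g + (w (h * g))⁻¹) * ‖v g‖ ^ 2 := by
  have hv := (L2.hasSum_sq v).summable
  have s₁ : Summable fun g => w g * ‖v g‖ ^ 2 :=
    .of_nonneg_of_le (fun g => mul_nonneg (hpos g).le (sq_nonneg _))
      (fun g => mul_le_mul_of_nonneg_right (hw g) (sq_nonneg _)) (hv.mul_left C)
  have s₂ : Summable fun g => (w (h * g))⁻¹ * ‖v g‖ ^ 2 :=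
    .of_nonneg_of_le (fun g => mul_nonneg (inv_nonneg.mpr (hpos _).le) (sq_nonneg _))
      (fun g => mul_le_mul_of_nonneg_right (hw' _) (sq_nonneg _)) (hv.mul_left C)
  have s₃ : HasSum (fun g => (w g)⁻¹ * ‖v (h⁻¹ * g)‖ ^ 2)
      (∑' g, (w (h * g))⁻¹ * ‖v g‖ ^ 2) := by
    refine (Equiv.mulLeft h).hasSum_iff.mp ?_
    simpa [Function.comp_def] using s₂.hasSum
  have hin := (Complex.reCLM.hasSum (lp.hasSum_inner v (leftRegular G h v))).mul_left 2
  have hsum : Summable fun g => (w g + (w (h * g))⁻¹) * ‖v g‖ ^ 2 := by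
    simpa only [add_mul] using s₁.add s₂
  refine ⟨hsum, ?_⟩
  have htot : ∑' g, (w g + (w (h * g))⁻¹) * ‖v g‖ ^ 2
      = ∑' g, w g * ‖v g‖ ^ 2 + ∑' g, (w (h * g))⁻¹ * ‖v g‖ ^ 2 := by
    simp only [add_mul]
    exact s₁.tsum_add s₂
  rw [htot]
  refine hasSum_le (fun g => ?_) hin (s₁.hasSum.add s₃)
  have hre : (inner ℂ (v g) (leftRegular G h v g)).re ≤ ‖v g‖ * ‖v (h⁻¹ * g)‖ :=
    (Complex.re_le_norm _).trans (norm_inner_le_norm _ _)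
  have hsq : 2 * (‖v g‖ * ‖v (h⁻¹ * g)‖) ≤ w g * ‖v g‖ ^ 2 + (w g)⁻¹ * ‖v (h⁻¹ * g)‖ ^ 2 := by
    have hg := hpos g
    have h0 : w g * ‖v g‖ ^ 2 + (w g)⁻¹ * ‖v (h⁻¹ * g)‖ ^ 2 - 2 * (‖v g‖ * ‖v (h⁻¹ * g)‖)
        = (w g)⁻¹ * (w g * ‖v g‖ - ‖v (h⁻¹ * g)‖) ^ 2 := by
      field_simp
      ring
    have h1 : 0 ≤ (w g)⁻¹ * (w g * ‖v g‖ - ‖v (h⁻¹ * g)‖) ^ 2 := by positivity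
    linarith
  change 2 * (inner ℂ (v g) (leftRegular G h v g)).re ≤ _
  linarith

open Classical in
/-- The weight of the vertex `g` of the Cayley tree on the edge from `g` to `aᵢ⁻¹ g`: it is `2` if
this edge leads towards the root, that is, if the reduced word of `g` starts with `aᵢ`, and `1/2`
otherwise. The weight of the other vertex on the same edge is the inverse. -/
noncomputable def edgeWeight (i : Fin 2) (g : F2) : ℝ :=
  if g ∈ FreeGroup.startsWith (i, true) then 2 else 1 / 2

theorem edgeWeight_pos (i : Fin 2) (g : F2) : 0 < edgeWeight i g := by
  unfold edgeWeight; split_ifs <;> norm_num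

theorem edgeWeight_le (i : Fin 2) (g : F2) : edgeWeight i g ≤ 2 := by
  unfold edgeWeight; split_ifs <;> norm_num

theorem inv_edgeWeight_le (i : Fin 2) (g : F2) : (edgeWeight i g)⁻¹ ≤ 2 := by
  unfold edgeWeight; split_ifs <;> norm_num

theorem edgeWeight_of_notMem {i : Fin 2} {g : F2} (h : g ∉ FreeGroup.startsWith (i, true)) :
    edgeWeight i g = 1 / 2 := if_neg h

theorem inv_edgeWeight_mul_of_notMem {i : Fin 2} {g : F2}
    (h : g ∉ FreeGroup.startsWith (i, false)) :
    (edgeWeight i (FreeGroup.of i * g))⁻¹ = 1 / 2 := by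
  have : FreeGroup.of i * g ∈ FreeGroup.startsWith (i, true) :=
    FreeGroup.startsWith_mk_mul (w := (i, true)) g h
  rw [edgeWeight, if_pos this, one_div]

/-- At most one of the four edges at a vertex of the Cayley tree leads towards the root. -/
theorem sum_edgeWeight_le (g : F2) :
    (edgeWeight 0 g + (edgeWeight 0 (FreeGroup.of 0 * g))⁻¹) +
      (edgeWeight 1 g + (edgeWeight 1 (FreeGroup.of 1 * g))⁻¹) ≤ 7 / 2 := by
  have hne {x y : Fin 2 × Bool} (hxy : x ≠ y) (hx : g ∈ FreeGroup.startsWith x) :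
      g ∉ FreeGroup.startsWith y :=
    (FreeGroup.startsWith.disjoint_iff_ne.mpr hxy).notMem_of_mem_left hx
  have b₀ := edgeWeight_le 0 g
  have b₁ := edgeWeight_le 1 g
  have c₀ := inv_edgeWeight_le 0 (FreeGroup.of 0 * g)
  have c₁ := inv_edgeWeight_le 1 (FreeGroup.of 1 * g)
  by_cases h₀ : g ∈ FreeGroup.startsWith ((0 : Fin 2), true)
  · rw [edgeWeight_of_notMem (hne (y := (1, true)) (by decide) h₀),
      inv_edgeWeight_mul_of_notMem (hne (y := (0, false)) (by decide) h₀),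
      inv_edgeWeight_mul_of_notMem (hne (y := (1, false)) (by decide) h₀)]
    linarith
  by_cases h₁ : g ∈ FreeGroup.startsWith ((1 : Fin 2), true)
  · rw [edgeWeight_of_notMem h₀,
      inv_edgeWeight_mul_of_notMem (hne (y := (0, false)) (by decide) h₁),
      inv_edgeWeight_mul_of_notMem (hne (y := (1, false)) (by decide) h₁)]
    linarith
  rw [edgeWeight_of_notMem h₀, edgeWeight_of_notMem h₁]
  by_cases h₂ : g ∈ FreeGroup.startsWith ((0 : Fin 2), false)
  · rw [inv_edgeWeight_mul_of_notMem (hne (y := (1, false)) (by decide) h₂)]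
    linarith
  · rw [inv_edgeWeight_mul_of_notMem h₂]
    linarith

theorem re_inner_leftRegular_add_le (v : L2 F2) :
    (inner ℂ v (leftRegular F2 (.of 0) v)).re + (inner ℂ v (leftRegular F2 (.of 1) v)).re
      ≤ 7 / 4 * ‖v‖ ^ 2 := by
  obtain ⟨s₀, h₀⟩ := two_mul_re_inner_leftRegular_le (.of 0) (edgeWeight 0) (edgeWeight_pos 0)
    (edgeWeight_le 0) (inv_edgeWeight_le 0) v
  obtain ⟨s₁, h₁⟩ := two_mul_re_inner_leftRegular_le (.of 1) (edgeWeight 1) (edgeWeight_pos 1)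
    (edgeWeight_le 1) (inv_edgeWeight_le 1) v
  have h := hasSum_le (fun g => ?_) (s₀.hasSum.add s₁.hasSum) ((L2.hasSum_sq v).mul_left (7 / 2))
  · linarith
  · rw [← add_mul]
    exact mul_le_mul_of_nonneg_right (sum_edgeWeight_le g) (sq_nonneg _)

/-! ### Invertibility of `2 - a₁ - a₂` -/

theorem norm_leftRegular_apply {G : Type*} [Group G] (h : G) (v : L2 G) :
    ‖leftRegular G h v‖ = ‖v‖ := by
  refine (sq_eq_sq₀ (norm_nonneg _) (norm_nonneg _)).mp ((L2.hasSum_sq _).unique ?_)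
  exact (Equiv.mulLeft h⁻¹).hasSum_iff.mpr (L2.hasSum_sq v)

/-- Expanding the square, `‖v + a₁ v + a₂ v‖² ≤ (3 + 2 (7 / 4 + 1)) ‖v‖² = 17 / 2 ‖v‖²`, where the
cross term of `a₁ v` and `a₂ v` is bounded by the Cauchy-Schwarz inequality alone. -/
theorem norm_one_add_leftRegular_add_lt :
    ‖1 + leftRegular F2 (.of 0) + leftRegular F2 (.of 1)‖ < 3 := by
  have hle : ‖1 + leftRegular F2 (.of 0) + leftRegular F2 (.of 1)‖ ≤ √(17 / 2) := by
    refine ContinuousLinearMap.opNorm_le_bound _ (Real.sqrt_nonneg _) fun v => ?_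
    refine le_of_sq_le_sq ?_ (by positivity)
    rw [mul_pow, Real.sq_sqrt (by norm_num)]
    change ‖v + leftRegular F2 (.of 0) v + leftRegular F2 (.of 1) v‖ ^ 2 ≤ _
    set x := leftRegular F2 (.of 0) v
    set y := leftRegular F2 (.of 1) v
    have nx : ‖x‖ = ‖v‖ := norm_leftRegular_apply _ v
    have ny : ‖y‖ = ‖v‖ := norm_leftRegular_apply _ v
    have hxy : (inner ℂ x y).re ≤ ‖v‖ ^ 2 := by
      refine (Complex.re_le_norm _).trans ((norm_inner_le_norm _ _).trans_eq ?_)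
      rw [nx, ny, sq]
    have hv := re_inner_leftRegular_add_le v
    have e₁ := norm_add_sq (𝕜 := ℂ) (v + x) y
    have e₂ := norm_add_sq (𝕜 := ℂ) v x
    rw [inner_add_left, map_add] at e₁
    simp only [RCLike.re_to_complex] at e₁ e₂
    rw [nx] at e₂
    rw [ny] at e₁
    linarith
  refine hle.trans_lt ?_
  rw [Real.sqrt_lt' (by norm_num)]
  norm_num

/-- In a closed subalgebra of a Banach algebra the Neumann series inverts the elements close
to `1`. -/
theorem Subalgebra.exists_mul_eq_one_of_norm_lt {A : Type*} [NormedRing A] [NormedAlgebra ℝ A]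
    [CompleteSpace A] {B : Subalgebra ℝ A} (hB : IsClosed (B : Set A)) {x : A} (hx : x ∈ B)
    (h : ‖x‖ < 1) : ∃ y ∈ B, (1 - x) * y = 1 ∧ y * (1 - x) = 1 := by
  have : CompleteSpace B := hB.completeSpace_coe
  let u := Units.oneSub (⟨x, hx⟩ : B) h
  exact ⟨(↑u⁻¹ : B), (↑u⁻¹ : B).2, congrArg Subtype.val u.mul_inv,
    congrArg Subtype.val u.inv_mul⟩

theorem leftRegular_mem_realReducedCStar {G : Type*} [Group G] (h : G) :
    leftRegular G h ∈ realReducedCStar G :=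
  Subalgebra.le_topologicalClosure _ ⟨MonoidAlgebra.of ℝ G h, MonoidAlgebra.lift_of _ _⟩

theorem exists_inverse_two_sub_leftRegular :
    ∃ s ∈ realReducedCStar F2,
      (2 - leftRegular F2 (.of 0) - leftRegular F2 (.of 1)) * s = 1 ∧
      s * (2 - leftRegular F2 (.of 0) - leftRegular F2 (.of 1)) = 1 := by
  set x := leftRegular F2 (.of 0)
  set y := leftRegular F2 (.of 1)
  have hmem : (1 / 3 : ℝ) • (1 + x + y) ∈ realReducedCStar F2 :=
    Subalgebra.smul_mem _ (add_mem (add_mem (one_mem _) (leftRegular_mem_realReducedCStar _))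
      (leftRegular_mem_realReducedCStar _)) _
  obtain ⟨z, hz, h₁, h₂⟩ := Subalgebra.exists_mul_eq_one_of_norm_lt
    (Subalgebra.isClosed_topologicalClosure _) hmem (by
      rw [norm_smul, Real.norm_of_nonneg (by norm_num)]
      linarith [norm_one_add_leftRegular_add_lt])
  have h3 : (1 : L2Op F2) - (1 / 3 : ℝ) • (1 + x + y) = (1 / 3 : ℝ) • (2 - x - y) := by
    rw [show (2 : L2Op F2) = 1 + 1 from one_add_one_eq_two.symm]
    module
  rw [h3] at h₁ h₂
  refine ⟨(1 / 3 : ℝ) • z, Subalgebra.smul_mem _ hz _, ?_, ?_⟩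
  · rwa [mul_smul_comm, ← smul_mul_assoc]
  · rwa [smul_mul_assoc, ← mul_smul_comm]

/-! ### The relations between `a₁ - 1` and `a₂ - 1` -/

theorem propositionD :
    ∃ u₁ ∈ realReducedCStar F2, ∃ u₂ ∈ realReducedCStar F2,
      u₁ * (leftRegular F2 (FreeGroup.of 0) - 1) + u₂ * (leftRegular F2 (FreeGroup.of 1) - 1) = 0 ∧
      ∀ (r : Fin 3) (v₁ v₂ : L2 (Fin 3 → F2)),
        L2.rightAct v₁ (leftRegular (Fin 3 → F2) (Pi.mulSingle r (FreeGroup.of 0)) - 1) +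
          L2.rightAct v₂ (leftRegular (Fin 3 → F2) (Pi.mulSingle r (FreeGroup.of 1)) - 1) = 0 →
        ∃! w : L2 (Fin 3 → F2),
          v₁ = L2.rightAct w (factorOp r u₁) ∧ v₂ = L2.rightAct w (factorOp r u₂) := by
  obtain ⟨s, hs, hs₁, hs₂⟩ := exists_inverse_two_sub_leftRegular
  set d₁ := leftRegular F2 (FreeGroup.of 0) - 1 with hd₁
  set d₂ := leftRegular F2 (FreeGroup.of 1) - 1 with hd₂
  have ht : 2 - leftRegular F2 (.of 0) - leftRegular F2 (.of 1) = -(d₁ + d₂) := by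
    rw [hd₁, hd₂, show (2 : L2Op F2) = 1 + 1 from one_add_one_eq_two.symm]
    abel
  rw [ht, neg_mul, neg_eq_iff_eq_neg] at hs₁
  rw [ht, mul_neg, neg_eq_iff_eq_neg] at hs₂
  have hmem : d₂ * s ∈ realReducedCStar F2 :=
    mul_mem (sub_mem (leftRegular_mem_realReducedCStar _) (one_mem _)) hs
  refine ⟨d₂ * s, hmem, 1 + d₂ * s, add_mem (one_mem _) hmem, ?_, fun r v₁ v₂ h => ?_⟩
  · calc d₂ * s * d₁ + (1 + d₂ * s) * d₂ = d₂ * (s * (d₁ + d₂)) + d₂ := by noncomm_ring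
      _ = 0 := by rw [hs₂, mul_neg_one, neg_add_cancel]
  · have hd (i : Fin 2) : leftRegular (Fin 3 → F2) (Pi.mulSingle r (.of i)) - 1
        = factorHom F2 r (leftRegular F2 (.of i) - 1) := by
      rw [map_sub, map_one, ← factorOp_leftRegular]
      rfl
    rw [hd, hd] at h
    have hs' : (factorHom F2 r d₁ + factorHom F2 r d₂) * factorHom F2 r s = -1 := by
      rw [← map_add, ← map_mul, hs₁, map_neg, map_one]
    have := existsUnique_syzygy (L2.rightActHom (Fin 3 → F2)) hs' h
    rwa [← map_mul, ← map_one (factorHom F2 r), ← map_add] at this
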